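/- Let $G$ be the group of real matrices $\begin{pmatrix}1&x&z\\0&1&y\\0&0&1\end{pmatrix}$ (the $3$-dimensional Heisenberg group), $\Gamma\subset G$ the subgroup of matrices with integer entries, $\Gamma\backslash G=\{\Gamma g: g\in G\}$ with the quotient topology, and $\mathbb T=\mathbb R/\mathbb Z$. Let $\alpha\in[0,1)$ be irrational and let $\varphi,\psi:\mathbb R\to\mathbb R$ be $C^\infty$ functions, periodic with period $1$, with $\int_0^1\varphi(t)\,dt=0$. Put $X=\mathbb T\times\Gamma\backslash G$ and let $T:X\to X$ be the skew product $$T(t,\Gamma g)=\left(t+\alpha,\ \Gamma g\begin{pmatrix}1&\varphi(t)&\psi(t)\\0&1&\varphi(t)\\0&0&1\end{pmatrix}\right).$$ For a metric $d$ on $X$ that induces its topology, $n\ge1$ and $x,y\in X$ put $\overline d_n(x,y)=\frac1n\sum_{j=0}^{n-1}d(T^jx,T^jy)$, and for a Borel probability measure $\rho$ on $X$ and $\varepsilon>0$ let $s_n(X,T,d,\rho,\varepsilon)$ be the least $m\in\mathbb N$ for which there are $x_1,\dots,x_m\in X$ with $$\rho\Big(\bigcup_{j=1}^m\{y\in X:\overline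 d_n(x_j,y)<\varepsilon\}\Big)>1-\varepsilon.$$ Then for every $T$-invariant Borel probability measure $\rho$ on $X$ the measure complexity of $(X,T,\rho)$ is sub-polynomial: for every metric $d$ on $X$ that induces its topology, every $\tau>0$ and every $\varepsilon>0$, $$\liminf_{n\to\infty}\frac{s_n(X,T,d,\rho,\varepsilon)}{n^\tau}=0.$$ -/

import Mathlib

open MeasureTheory Filter Topology
open scoped ENNReal ContDiff

/-- The real Heisenberg group `G`: the element `⟨x, y, z⟩` stands for the unitriangular matrix
`!![1, x, z; 0, 1, y; 0, 0, 1]`. -/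
@[ext]
structure Heisenberg where
  x : ℝ
  y : ℝ
  z : ℝ

namespace Heisenberg

instance : Mul Heisenberg := ⟨fun g h => ⟨g.x + h.x, g.y + h.y, g.z + h.z + g.x * h.y⟩⟩
instance : One Heisenberg := ⟨⟨0, 0, 0⟩⟩
instance : Inv Heisenberg := ⟨fun g => ⟨-g.x, -g.y, g.x * g.y - g.z⟩⟩

@[simp] theorem mul_x (g h : Heisenberg) : (g * h).x = g.x + h.x := rfl
@[simp] theorem mul_y (g h : Heisenberg) : (g * h).y = g.y + h.y := rfl
@[simp] theorem mul_z (g h : Heisenberg) : (g * h).z = g.z + h.z + g.x * h.y := rfl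
@[simp] theorem one_x : (1 : Heisenberg).x = 0 := rfl
@[simp] theorem one_y : (1 : Heisenberg).y = 0 := rfl
@[simp] theorem one_z : (1 : Heisenberg).z = 0 := rfl
@[simp] theorem inv_x (g : Heisenberg) : g⁻¹.x = -g.x := rfl
@[simp] theorem inv_y (g : Heisenberg) : g⁻¹.y = -g.y := rfl
@[simp] theorem inv_z (g : Heisenberg) : g⁻¹.z = g.x * g.y - g.z := rfl

instance : Group Heisenberg :=
  Group.ofLeftAxioms
    (fun a b c => by ext <;> simp <;> ring)
    (fun a => by ext <;> simp)
    (fun a => by ext <;> simp)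

/-- The matrix that a triple stands for. -/
def toMatrix (g : Heisenberg) : Matrix (Fin 3) (Fin 3) ℝ :=
  !![1, g.x, g.z; 0, 1, g.y; 0, 0, 1]

/-- The group law is matrix multiplication. -/
theorem toMatrix_mul (g h : Heisenberg) : (g * h).toMatrix = g.toMatrix * h.toMatrix := by
  ext i j
  fin_cases i <;> fin_cases j <;> simp [toMatrix, Matrix.mul_apply, Fin.sum_univ_three] <;> ring

/-- The coordinates `(x, y, z)`. -/
def coords : Heisenberg ≃ ℝ × ℝ × ℝ where
  toFun g := (g.x, g.y, g.z)
  invFun p := ⟨p.1, p.2.1, p.2.2⟩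
  left_inv _ := rfl
  right_inv _ := rfl

/-- The usual topology of `ℝ³`. -/
instance : TopologicalSpace Heisenberg := TopologicalSpace.induced coords inferInstance

/-- The coordinates as a homeomorphism. -/
def coordsHomeo : Heisenberg ≃ₜ ℝ × ℝ × ℝ := coords.toHomeomorphOfIsInducing ⟨rfl⟩

theorem continuous_x : Continuous Heisenberg.x := coordsHomeo.continuous.fst
theorem continuous_y : Continuous Heisenberg.y := coordsHomeo.continuous.snd.fst
theorem continuous_z : Continuous Heisenberg.z := coordsHomeo.continuous.snd.snd

theorem continuous_of_coords {X : Type*} [TopologicalSpace X] {f : X → Heisenberg}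
    (hx : Continuous fun a => (f a).x) (hy : Continuous fun a => (f a).y)
    (hz : Continuous fun a => (f a).z) : Continuous f :=
  coordsHomeo.comp_continuous_iff.1 (hx.prodMk (hy.prodMk hz))

instance : IsTopologicalGroup Heisenberg where
  continuous_mul := by
    have hx := continuous_x
    have hy := continuous_y
    have hz := continuous_z
    apply continuous_of_coords <;> simp only [mul_x, mul_y, mul_z] <;> fun_prop
  continuous_inv := by
    have hx := continuous_x
    have hy := continuous_y
    have hz := continuous_z
    apply continuous_of_coords <;> simp only [inv_x, inv_y, inv_z] <;> fun_prop

instance : T2Space Heisenberg := coordsHomeo.isEmbedding.t2Space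
instance : SecondCountableTopology Heisenberg := coordsHomeo.secondCountableTopology
instance : LocallyCompactSpace Heisenberg :=
  coordsHomeo.isClosedEmbedding.locallyCompactSpace

/-- The subgroup `Γ` of integer points. -/
def lattice : Subgroup Heisenberg where
  carrier := {g | ∃ a b c : ℤ, g = ⟨a, b, c⟩}
  mul_mem' := by
    rintro _ _ ⟨a, b, c, rfl⟩ ⟨a', b', c', rfl⟩
    exact ⟨a + a', b + b', c + c' + a * b', by ext <;> simp⟩
  one_mem' := ⟨0, 0, 0, by ext <;> simp⟩
  inv_mem' := by
    rintro _ ⟨a, b, c, rfl⟩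
    exact ⟨-a, -b, a * b - c, by ext <;> simp⟩

end Heisenberg

/-- The Heisenberg nilmanifold `Γ \ G`: the space of cosets `Γ g`, that is, of orbits of the left
multiplication action of `Γ` on `G`. -/
def HeisenbergNilmanifold : Type := Quotient (QuotientGroup.rightRel Heisenberg.lattice)

namespace HeisenbergNilmanifold

/-- The coset `Γ g`. -/
def mk (g : Heisenberg) : HeisenbergNilmanifold :=
  Quotient.mk (QuotientGroup.rightRel Heisenberg.lattice) g

/-- The quotient topology. -/
instance : TopologicalSpace HeisenbergNilmanifold :=
  inferInstanceAs (TopologicalSpace (Quotient (QuotientGroup.rightRel Heisenberg.lattice)))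

/-- The Borel `σ`-algebra. -/
instance : MeasurableSpace HeisenbergNilmanifold := borel _
instance : BorelSpace HeisenbergNilmanifold := ⟨rfl⟩

/-- Right translation `Γ g ↦ Γ g h`. -/
def rightTranslate (h : Heisenberg) : HeisenbergNilmanifold → HeisenbergNilmanifold :=
  Quotient.map (fun g => g * h) (by
    intro a b hab
    rw [← Quotient.eq_iff_equiv, Quotient.eq, QuotientGroup.rightRel_apply] at hab ⊢
    simpa [mul_assoc] using hab)

theorem rightTranslate_mk (g h : Heisenberg) : rightTranslate h (mk g) = mk (g * h) := rfl

/-- Two points of `G` give the same coset iff they differ by an element of `Γ` on the left. -/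
theorem mk_eq_mk_iff (g h : Heisenberg) :
    mk g = mk h ↔ ∃ γ ∈ Heisenberg.lattice, h = γ * g := by
  refine (Quotient.eq (r := QuotientGroup.rightRel Heisenberg.lattice)).trans ?_
  rw [QuotientGroup.rightRel_apply]
  exact ⟨fun H => ⟨_, H, by simp⟩, by rintro ⟨γ, H, rfl⟩; simpa using H⟩

instance : SecondCountableTopology HeisenbergNilmanifold :=
  ContinuousConstSMul.secondCountableTopology (Γ := Heisenberg.lattice) (T := Heisenberg)

instance : CompactSpace HeisenbergNilmanifold := by
  let K : Set Heisenberg := Heisenberg.coordsHomeo ⁻¹'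
    (Set.Icc 0 1 ×ˢ Set.Icc 0 1 ×ˢ Set.Icc 0 1)
  have hK : IsCompact K := Heisenberg.coordsHomeo.isCompact_preimage.2
    (isCompact_Icc.prod (isCompact_Icc.prod isCompact_Icc))
  have hc : Continuous mk := continuous_quotient_mk'
  refine ⟨?_⟩
  convert hK.image hc using 1
  symm
  rw [Set.eq_univ_iff_forall]
  intro p
  induction p using Quotient.inductionOn with
  | h g =>
    let γ : Heisenberg := ⟨(-⌊g.x⌋ : ℤ), (-⌊g.y⌋ : ℤ), (-⌊g.z + (-⌊g.x⌋ : ℤ) * g.y⌋ : ℤ)⟩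
    refine ⟨γ * g, ?_, ((mk_eq_mk_iff g (γ * g)).2 ⟨γ, ⟨_, _, _, rfl⟩, rfl⟩).symm⟩
    have h1 := Int.floor_le g.x
    have h2 := Int.lt_floor_add_one g.x
    have h3 := Int.floor_le g.y
    have h4 := Int.lt_floor_add_one g.y
    have h5 := Int.floor_le (g.z + (-⌊g.x⌋ : ℤ) * g.y)
    have h6 := Int.lt_floor_add_one (g.z + (-⌊g.x⌋ : ℤ) * g.y)
    refine ⟨⟨?_, ?_⟩, ⟨?_, ?_⟩, ?_, ?_⟩ <;>
      simp only [γ, Heisenberg.coordsHomeo, Heisenberg.coords,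
        Equiv.toHomeomorphOfIsInducing_apply, Equiv.coe_fn_mk, Heisenberg.mul_x, Heisenberg.mul_y,
        Heisenberg.mul_z] <;> push_cast at * <;> linarith

instance : T2Space HeisenbergNilmanifold := by
  have hS : Tendsto Heisenberg.lattice.subtype cofinite (cocompact Heisenberg) := by
    let e : Heisenberg.lattice → ℤ × ℤ × ℤ := fun γ => (⌊γ.1.x⌋, ⌊γ.1.y⌋, ⌊γ.1.z⌋)
    let f : ℤ × ℤ × ℤ → ℝ × ℝ × ℝ := Prod.map (↑) (Prod.map (↑) (↑))
    have hfe : ∀ γ : Heisenberg.lattice, Heisenberg.coordsHomeo.symm (f (e γ)) = γ := by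
      rintro ⟨_, a, b, c, rfl⟩
      rw [Homeomorph.symm_apply_eq]
      simp [f, e, Heisenberg.coordsHomeo, Heisenberg.coords]
    have he : Function.Injective e := fun a b h => by
      apply Subtype.ext
      rw [← hfe a, ← hfe b, h]
    have hf : Tendsto f cofinite (cocompact _) := by
      have h := Int.tendsto_coe_cofinite
      rw [← coprod_cofinite, ← coprod_cofinite, ← coprod_cocompact, ← coprod_cocompact]
      exact h.prodMap_coprod (h.prodMap_coprod h)
    have h := (Heisenberg.coordsHomeo.symm.isClosedEmbedding.tendsto_cocompact.comp hf).comp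
      he.tendsto_cofinite
    exact h.congr hfe
  have := Heisenberg.lattice.properlyDiscontinuousSMul_of_tendsto_cofinite hS
  exact t2Space_of_properlyDiscontinuousSMul_of_t2Space (Γ := Heisenberg.lattice)
    (T := Heisenberg)

end HeisenbergNilmanifold

/-- The skew product `(t, Γ g) ↦ (t + α, Γ g ⟨φ(t), φ(t), ψ(t)⟩)` on `𝕋 × Γ \ G`, where `𝕋 = ℝ/ℤ`
and the `1`-periodic functions `φ`, `ψ` are read as functions on `𝕋`. -/
noncomputable def skewProduct (α : ℝ) {φ ψ : ℝ → ℝ} (hφ : Function.Periodic φ 1)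
    (hψ : Function.Periodic ψ 1) (p : UnitAddCircle × HeisenbergNilmanifold) :
    UnitAddCircle × HeisenbergNilmanifold :=
  (p.1 + (α : UnitAddCircle),
    HeisenbergNilmanifold.rightTranslate ⟨hφ.lift p.1, hφ.lift p.1, hψ.lift p.1⟩ p.2)

section MeasureComplexity

variable {X : Type*}

/-- The averaged orbit distance `(1/n) ∑_{j < n} d (T^j x) (T^j y)`. -/
noncomputable def meanOrbitDist (d : X → X → ℝ) (T : X → X) (n : ℕ) (x y : X) : ℝ :=
  (1 / (n : ℝ)) * ∑ j ∈ Finset.range n, d (T^[j] x) (T^[j] y)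

/-- The ball of radius `ε` around `x` for the averaged orbit distance. -/
def meanOrbitBall (d : X → X → ℝ) (T : X → X) (n : ℕ) (x : X) (ε : ℝ) : Set X :=
  {y | meanOrbitDist d T n x y < ε}

/-- `s_n(X, T, d, ρ, ε)`: the least `m` such that some `m` balls of radius `ε` for the averaged
orbit distance have a union of measure greater than `1 - ε` (it is `⊤` if there is no such `m`). -/
noncomputable def coveringNumber [MeasurableSpace X] (d : X → X → ℝ) (T : X → X) (ρ : Measure X)
    (ε : ℝ) (n : ℕ) : ℕ∞ :=
  ⨅ (m : ℕ) (_ : ∃ c : Fin m → X, 1 - ε < ρ.real (⋃ j, meanOrbitBall d T n (c j) ε)), (m : ℕ∞)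

/-- The measure complexity of `(X, d, T, ρ)` is weaker than `u`. -/
def MeasureComplexityWeakerFor [MeasurableSpace X] (d : X → X → ℝ) (T : X → X) (ρ : Measure X)
    (u : ℕ → ℝ) : Prop :=
  ∀ ε : ℝ, 0 < ε →
    liminf (fun n : ℕ => (coveringNumber d T ρ ε n : ℝ≥0∞) / ENNReal.ofReal (u n)) atTop = 0

/-- The measure complexity of `(X, T, ρ)` is weaker than `u`: this holds for every metric that
induces the topology of `X`. -/
def MeasureComplexityWeaker [TopologicalSpace X] [MeasurableSpace X] (T : X → X)
    (ρ : Measure X) (u : ℕ → ℝ) : Prop :=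
  ∀ m : MetricSpace X, m.toUniformSpace.toTopologicalSpace = ‹TopologicalSpace X› →
    MeasureComplexityWeakerFor m.dist T ρ u

/-- The measure complexity of `(X, T, ρ)` is sub-polynomial. -/
def SubpolynomialMeasureComplexity [TopologicalSpace X] [MeasurableSpace X] (T : X → X)
    (ρ : Measure X) : Prop :=
  ∀ τ : ℝ, 0 < τ → MeasureComplexityWeaker T ρ (fun n : ℕ => (n : ℝ) ^ τ)

end MeasureComplexity

/-- The derivative of a periodic function is periodic. -/
theorem periodic_deriv {f : ℝ → ℝ} {c : ℝ} (hp : Function.Periodic f c) :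
    Function.Periodic (deriv f) c := by
  intro x
  rw [← deriv_comp_add_const f c x]
  congr 1
  exact funext hp

/-- The derivative of a periodic function has mean zero. -/
theorem integral_deriv_eq_zero_of_periodic {f : ℝ → ℝ} (hf : ContDiff ℝ ∞ f)
    (hp : Function.Periodic f 1) : ∫ t in (0 : ℝ)..1, deriv f t = 0 := by
  rw [intervalIntegral.integral_deriv_eq_sub
    (fun x _ => (hf.differentiable (by simp)).differentiableAt)
    ((hf.continuous_deriv (by simp)).intervalIntegrable _ _)]
  simpa [sub_eq_zero] using hp 0

/-! ### Decay of the Fourier coefficients -/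

theorem norm_fourierCoeffOn_le {f : ℝ → ℂ} {C : ℝ} (hC : ∀ x ∈ Set.Icc (0 : ℝ) 1, ‖f x‖ ≤ C)
    (m : ℤ) : ‖fourierCoeffOn (zero_lt_one' ℝ) f m‖ ≤ C := by
  rw [fourierCoeffOn_eq_integral]
  have h : ∀ x ∈ Set.uIoc (0 : ℝ) 1,
      ‖fourier (-m) (x : AddCircle ((1 : ℝ) - 0)) • f x‖ ≤ C := by
    intro x hx
    rw [Set.uIoc_of_le zero_le_one] at hx
    rw [norm_smul, fourier_apply, Circle.norm_coe, one_mul]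
    exact hC x ⟨hx.1.le, hx.2⟩
  simpa using intervalIntegral.norm_integral_le_of_norm_le_const h

/-- The Fourier coefficients of a smooth periodic function decay faster than any power. -/
theorem exists_norm_fourierCoeffOn_mul_pow_le (N : ℕ) {f : ℝ → ℝ} (hf : ContDiff ℝ ∞ f)
    (hp : Function.Periodic f 1) :
    ∃ C : ℝ, 0 ≤ C ∧ ∀ m : ℤ, m ≠ 0 →
      ‖fourierCoeffOn (zero_lt_one' ℝ) (fun t => (f t : ℂ)) m‖ * |(m : ℝ)| ^ N ≤ C := by
  induction N generalizing f with
  | zero =>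
    obtain ⟨C, hC⟩ := (isCompact_Icc (a := (0 : ℝ)) (b := 1)).exists_bound_of_continuousOn
      hf.continuous.continuousOn
    refine ⟨C, (norm_nonneg _).trans (hC 0 (by simp)), fun m _ => ?_⟩
    rw [pow_zero, mul_one]
    exact norm_fourierCoeffOn_le (fun x hx => by simpa using hC x hx) m
  | succ N ih =>
    obtain ⟨C, hC0, hC⟩ := ih ((contDiff_infty_iff_deriv.1 hf).2) (periodic_deriv hp)
    refine ⟨C, hC0, fun m hm => ?_⟩
    have hd : ∀ x, HasDerivAt (fun t => (f t : ℂ)) ((deriv f x : ℝ) : ℂ) x := fun x =>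
      ((hf.differentiable (by simp)).differentiableAt.hasDerivAt).ofReal_comp
    have hi : IntervalIntegrable (fun x => ((deriv f x : ℝ) : ℂ)) volume 0 1 :=
      (Complex.continuous_ofReal.comp (hf.continuous_deriv (by simp))).intervalIntegrable _ _
    have h10 : f 1 = f 0 := by simpa using hp 0
    have hmpos : 0 < |(m : ℝ)| := abs_pos.2 (Int.cast_ne_zero.2 hm)
    rw [fourierCoeffOn_of_hasDerivAt (zero_lt_one' ℝ) hm (fun x _ => hd x) hi, h10]
    have hpi : (1 : ℝ) ≤ 2 * Real.pi := by linarith [Real.pi_gt_three]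
    have hn : ‖(1 : ℂ) / (-2 * Real.pi * Complex.I * m)‖ = (2 * Real.pi)⁻¹ * |(m : ℝ)|⁻¹ := by
      simp [abs_of_pos Real.pi_pos, mul_comm]
    rw [norm_mul, hn]
    simp only [sub_self, mul_zero, zero_sub, norm_neg, Complex.ofReal_one, Complex.ofReal_zero,
      sub_zero, one_mul]
    calc _ = (2 * Real.pi)⁻¹ * (‖fourierCoeffOn (zero_lt_one' ℝ)
          (fun t => ((deriv f t : ℝ) : ℂ)) m‖ * |(m : ℝ)| ^ N) := by
          rw [pow_succ]; field_simp
      _ ≤ 1 * C := mul_le_mul (inv_le_one_of_one_le₀ hpi) (hC m hm) (by positivity) zero_le_one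
      _ = C := one_mul C

/-- A smooth periodic function is the sum of its Fourier series. -/
theorem hasSum_fourierCoeffOn_of_smooth {f : ℝ → ℝ} (hf : ContDiff ℝ ∞ f)
    (hp : Function.Periodic f 1) (t : ℝ) :
    HasSum (fun m : ℤ => fourierCoeffOn (zero_lt_one' ℝ) (fun t => (f t : ℂ)) m *
      Complex.exp (2 * Real.pi * Complex.I * m * t)) (f t : ℂ) := by
  have hpc : Function.Periodic (fun t => (f t : ℂ)) 1 := fun x => by simp only [hp x]
  let F : C(UnitAddCircle, ℂ) := ⟨hpc.lift, by
    refine continuous_quot_lift _ ?_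
    exact Complex.continuous_ofReal.comp hf.continuous⟩
  have hFc : ∀ x : ℝ, F (x : UnitAddCircle) = f x := fun _ => rfl
  have hF : ∀ m, fourierCoeff F m = fourierCoeffOn (zero_lt_one' ℝ) (fun t => (f t : ℂ)) m := by
    intro m
    rw [fourierCoeff_eq_intervalIntegral _ _ 0, fourierCoeffOn_eq_integral]
    simp [hFc]
  have hsum : Summable (fourierCoeff F) := by
    obtain ⟨C, hC0, hC⟩ := exists_norm_fourierCoeffOn_mul_pow_le 2 hf hp
    refine Summable.of_norm_bounded_eventually
      ((Real.summable_one_div_int_pow (p := 2).2 one_lt_two).mul_left C) ?_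
    rw [Filter.eventually_cofinite]
    refine (Set.finite_singleton (0 : ℤ)).subset fun m hm => ?_
    by_contra h
    have h0 : m ≠ 0 := h
    refine hm ?_
    have h2 := hC m h0
    have : 0 < (m : ℝ) ^ 2 := by positivity
    rw [hF, mul_one_div, le_div_iff₀ this, ← sq_abs]
    exact h2
  have h := has_pointwise_sum_fourier_series_of_summable hsum (t : UnitAddCircle)
  simpa [hF, hFc, fourier_coe_apply] using h

/-! ### Diophantine approximation -/

/-- `Q` is a natural number for which the multiples `m α`, `0 < |m| < Q`, stay away from the
integers by at least `1 / Q ^ 2`. -/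
def SeparatedUpTo (α : ℝ) (Q : ℕ) : Prop :=
  ∀ m k : ℤ, m ≠ 0 → |m| < Q → 1 / (Q : ℝ) ^ 2 ≤ |m * α - k|

theorem separatedUpTo_den {α : ℝ} {q : ℚ} (h : |α - q| < 1 / (q.den : ℝ) ^ 2) :
    SeparatedUpTo α q.den := by
  intro m k hm hmq
  have hq : (0 : ℝ) < q.den := by exact_mod_cast q.den_pos
  have hne : m * q.num - k * q.den ≠ 0 := by
    intro h0
    have hdvd : (q.den : ℤ) ∣ m * q.num := ⟨k, by linarith⟩
    have hcop : IsCoprime (q.den : ℤ) q.num := by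
      rw [Int.isCoprime_iff_gcd_eq_one, Int.gcd_comm]
      simpa [Int.gcd] using q.reduced
    have := hcop.dvd_of_dvd_mul_right hdvd
    have := Int.le_of_dvd (abs_pos.2 hm) ((dvd_abs _ _).2 this)
    omega
  have h1 : (1 : ℝ) ≤ |(m : ℝ) * q.num - k * q.den| := by
    exact_mod_cast Int.one_le_abs hne
  have hm1 : |(m : ℝ)| ≤ q.den - 1 := by
    have : |m| ≤ q.den - 1 := by omega
    exact_mod_cast this
  have hqq : (q : ℝ) * q.den = q.num := by exact_mod_cast Rat.mul_den_eq_num q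
  have h2 : |(m : ℝ) * q.num - k * q.den| ≤ q.den * |m * α - k| + |(m : ℝ)| * (q.den * |α - q|) := by
    calc _ = |q.den * (m * α - k) - m * (q.den * (α - q))| := by
          congr 1; rw [← hqq]; ring
      _ ≤ _ := by
          refine (abs_sub _ _).trans ?_
          simp [abs_mul]
  have h3 : (q.den : ℝ) * |α - q| ≤ 1 / q.den := by
    calc (q.den : ℝ) * |α - q| ≤ q.den * (1 / (q.den : ℝ) ^ 2) := by gcongr
      _ = 1 / q.den := by field_simp
  have h4 : |(m : ℝ)| * (q.den * |α - q|) ≤ (q.den - 1) * (1 / q.den) :=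
    mul_le_mul hm1 h3 (by positivity) ((abs_nonneg _).trans hm1)
  have h5 : ((q.den : ℝ) - 1) * (1 / q.den) = 1 - 1 / q.den := by field_simp
  have h6 : 1 / (q.den : ℝ) ≤ q.den * |m * α - k| := by linarith
  calc 1 / (q.den : ℝ) ^ 2 = (1 / q.den) / q.den := by field_simp
    _ ≤ |m * α - k| := by rw [div_le_iff₀ hq]; linarith

theorem frequently_separatedUpTo {α : ℝ} (hα : Irrational α) :
    ∃ᶠ Q : ℕ in atTop, SeparatedUpTo α Q := by
  rw [Filter.frequently_atTop]
  intro B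
  by_contra! hB
  refine Real.infinite_rat_abs_sub_lt_one_div_den_sq_of_irrational hα ?_
  obtain ⟨R, hR⟩ := exists_nat_gt ((|α| + 1) * B)
  refine ((Set.finite_Icc (-(R : ℤ)) R).prod (Set.finite_Iio B)).image
    (fun p : ℤ × ℕ => (p.1 : ℚ) / p.2) |>.subset fun q hq => ?_
  have hden : q.den < B := by
    by_contra! h
    exact hB _ h (separatedUpTo_den hq)
  refine ⟨(q.num, q.den), ⟨abs_le.1 ?_, hden⟩, Rat.num_div_den q⟩
  have hq1 : (1 : ℝ) ≤ q.den := by exact_mod_cast q.den_pos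
  have h1 : |α - q| < 1 := lt_of_lt_of_le hq (by
    rw [div_le_one (by positivity)]; exact one_le_pow₀ hq1)
  have h2 : |(q : ℝ)| ≤ |α| + 1 := by
    have := abs_sub_abs_le_abs_sub (q : ℝ) α
    rw [abs_sub_comm] at this
    linarith
  have hqq : (q : ℝ) * q.den = q.num := by exact_mod_cast Rat.mul_den_eq_num q
  have h3 : |(q.num : ℝ)| ≤ R := by
    rw [← hqq, abs_mul, abs_of_pos (by linarith : (0 : ℝ) < q.den)]
    refine le_trans ?_ hR.le
    have : (q.den : ℝ) ≤ B := by exact_mod_cast hden.le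
    exact mul_le_mul h2 this (by positivity) (by positivity)
  exact_mod_cast h3

/-! ### Birkhoff sums over a rotation -/

/-- The Birkhoff sum of `f` over the rotation by `α`. -/
noncomputable def rotationSum (α : ℝ) (f : ℝ → ℝ) (j : ℕ) (t : ℝ) : ℝ :=
  ∑ i ∈ Finset.range j, f (t + i * α)

theorem norm_exp_sub_one_ge (x : ℝ) (δ : ℝ) (h : ∀ k : ℤ, δ ≤ |x - k|) :
    4 * δ ≤ ‖Complex.exp (2 * Real.pi * Complex.I * x) - 1‖ := by
  have e : Complex.exp (2 * Real.pi * Complex.I * x)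
      = Complex.exp (Complex.I * ((2 * Real.pi * (x - round x) : ℝ) : ℂ)) := by
    rw [Complex.exp_eq_exp_iff_exists_int]
    refine ⟨round x, ?_⟩
    push_cast
    ring
  rw [e, Complex.norm_exp_I_mul_ofReal_sub_one]
  have hr := abs_sub_round x
  have hs := Real.mul_abs_le_abs_sin (x := Real.pi * (x - round x)) (by
    rw [abs_mul, abs_of_pos Real.pi_pos]; nlinarith [Real.pi_pos])
  rw [abs_mul, abs_of_pos Real.pi_pos] at hs
  have h2 : 2 / Real.pi * (Real.pi * |x - round x|) = 2 * |x - round x| := by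
    field_simp
  rw [h2] at hs
  have h3 : 2 * Real.pi * (x - round x) / 2 = Real.pi * (x - round x) := by ring
  rw [h3, norm_mul, Real.norm_eq_abs, Real.norm_eq_abs, abs_two]
  linarith [h (round x)]

theorem norm_geom_sum_le {w : ℂ} (hw : ‖w‖ = 1) {δ : ℝ} (hδ : 0 < δ) (h : 4 * δ ≤ ‖w - 1‖)
    (j : ℕ) : ‖∑ i ∈ Finset.range j, w ^ i‖ ≤ 1 / δ := by
  have h1 : ‖∑ i ∈ Finset.range j, w ^ i‖ * ‖w - 1‖ ≤ 2 := by
    rw [← norm_mul, geom_sum_mul]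
    refine (norm_sub_le _ _).trans ?_
    simp [hw]
    norm_num
  rw [le_div_iff₀ hδ]
  nlinarith [norm_nonneg (∑ i ∈ Finset.range j, w ^ i)]

/-- Birkhoff sums of length at most `Q ^ M` of a smooth function of mean zero are `O(Q ^ 2)`. -/
theorem exists_abs_rotationSum_le (α : ℝ) (M : ℕ) {f : ℝ → ℝ} (hf : ContDiff ℝ ∞ f)
    (hp : Function.Periodic f 1) (h0 : ∫ t in (0 : ℝ)..1, f t = 0) :
    ∃ C : ℝ, 0 ≤ C ∧ ∀ Q : ℕ, 0 < Q → SeparatedUpTo α Q → ∀ j ≤ Q ^ M, ∀ t : ℝ,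
      |rotationSum α f j t| ≤ C * (Q : ℝ) ^ 2 := by
  obtain ⟨C, hC0, hC⟩ := exists_norm_fourierCoeffOn_mul_pow_le (M + 2) hf hp
  set c : ℤ → ℂ := fourierCoeffOn (zero_lt_one' ℝ) (fun t => (f t : ℂ)) with hc
  have hc0 : c 0 = 0 := by
    rw [hc, fourierCoeffOn_eq_integral]
    simp [intervalIntegral.integral_ofReal, h0]
  have hsum := Real.summable_one_div_int_pow (p := 2).2 one_lt_two
  refine ⟨C * ∑' m : ℤ, 1 / (m : ℝ) ^ 2, mul_nonneg hC0 (tsum_nonneg fun m => by positivity),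
    fun Q hQ hsep j hj t => ?_⟩
  let w : ℤ → ℂ := fun m => Complex.exp (2 * Real.pi * Complex.I * ((m * α : ℝ) : ℂ))
  have hw : ∀ m, ‖w m‖ = 1 := fun m => by
    have : 2 * Real.pi * Complex.I * ((m * α : ℝ) : ℂ)
        = ((2 * Real.pi * (m * α) : ℝ) : ℂ) * Complex.I := by push_cast; ring
    simp only [w]
    rw [this, Complex.norm_exp_ofReal_mul_I]
  have hS : HasSum (fun m : ℤ => c m * Complex.exp (2 * Real.pi * Complex.I * m * t) *
      ∑ i ∈ Finset.range j, w m ^ i) (rotationSum α f j t : ℂ) := by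
    have := hasSum_sum (s := Finset.range j)
      (fun i _ => hasSum_fourierCoeffOn_of_smooth hf hp (t + i * α))
    simp only [rotationSum, Complex.ofReal_sum]
    convert! this using 2 with m
    rw [Finset.mul_sum]
    refine Finset.sum_congr rfl fun i _ => ?_
    rw [← Complex.exp_nat_mul, mul_assoc, ← Complex.exp_add]
    congr 2
    push_cast
    ring
  have hQ1 : (1 : ℝ) ≤ Q := by exact_mod_cast hQ
  have hb : ∀ m : ℤ, ‖c m * Complex.exp (2 * Real.pi * Complex.I * m * t) *
      ∑ i ∈ Finset.range j, w m ^ i‖ ≤ C * (Q : ℝ) ^ 2 * (1 / (m : ℝ) ^ 2) := by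
    intro m
    rcases eq_or_ne m 0 with rfl | hm
    · simp [hc0]
    have he : ‖Complex.exp (2 * Real.pi * Complex.I * m * t)‖ = 1 := by
      have : 2 * Real.pi * Complex.I * m * t
          = ((2 * Real.pi * m * t : ℝ) : ℂ) * Complex.I := by push_cast; ring
      rw [this, Complex.norm_exp_ofReal_mul_I]
    rw [norm_mul, norm_mul, he, mul_one, mul_one_div, le_div_iff₀ (by positivity)]
    have hm1 : (1 : ℝ) ≤ |(m : ℝ)| := by exact_mod_cast Int.one_le_abs hm
    have hCm := hC m hm
    rw [pow_add, sq_abs] at hCm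
    have hnn : 0 ≤ ‖c m‖ * (m : ℝ) ^ 2 := by positivity
    by_cases hmQ : |m| < Q
    · have hg : ‖∑ i ∈ Finset.range j, w m ^ i‖ ≤ (Q : ℝ) ^ 2 := by
        have := norm_geom_sum_le (hw m) (δ := 1 / (Q : ℝ) ^ 2) (by positivity)
          (norm_exp_sub_one_ge _ _ fun k => hsep m k hm hmQ) j
        simpa using this
      have h1 : ‖c m‖ * (m : ℝ) ^ 2 ≤ C := by
        refine le_trans ?_ hCm
        have : (1 : ℝ) ≤ |(m : ℝ)| ^ M := one_le_pow₀ hm1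
        nlinarith
      calc _ = (‖c m‖ * (m : ℝ) ^ 2) * ‖∑ i ∈ Finset.range j, w m ^ i‖ := by ring
        _ ≤ C * (Q : ℝ) ^ 2 := mul_le_mul h1 hg (norm_nonneg _) hC0
    · have hg : ‖∑ i ∈ Finset.range j, w m ^ i‖ ≤ |(m : ℝ)| ^ M := by
        refine (norm_sum_le _ _).trans ?_
        simp only [norm_pow, hw, one_pow, Finset.sum_const, Finset.card_range, nsmul_eq_mul,
          mul_one]
        have h1 : (j : ℝ) ≤ (Q : ℝ) ^ M := by exact_mod_cast hj
        have h2 : (Q : ℝ) ≤ |(m : ℝ)| := by exact_mod_cast not_lt.1 hmQ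
        exact h1.trans (pow_le_pow_left₀ (by positivity) h2 M)
      calc _ = (‖c m‖ * (m : ℝ) ^ 2) * ‖∑ i ∈ Finset.range j, w m ^ i‖ := by ring
        _ ≤ (‖c m‖ * (m : ℝ) ^ 2) * |(m : ℝ)| ^ M := by gcongr
        _ = ‖c m‖ * (|(m : ℝ)| ^ M * (m : ℝ) ^ 2) := by ring
        _ ≤ C := hCm
        _ ≤ C * (Q : ℝ) ^ 2 := le_mul_of_one_le_right hC0 (one_le_pow₀ hQ1)
  have := hS.norm_le_of_bounded (hsum.hasSum.mul_left (C * (Q : ℝ) ^ 2)) hb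
  rw [Complex.norm_real, Real.norm_eq_abs] at this
  linarith

theorem hasDerivAt_rotationSum (α : ℝ) {f : ℝ → ℝ} (hf : Differentiable ℝ f) (j : ℕ) (t : ℝ) :
    HasDerivAt (rotationSum α f j) (rotationSum α (deriv f) j t) t := by
  simp only [rotationSum]
  refine HasDerivAt.fun_sum fun i _ => ?_
  exact HasDerivAt.comp_add_const t (i * α) (hf _).hasDerivAt

theorem abs_rotationSum_sub_le {α : ℝ} {f : ℝ → ℝ} (hf : Differentiable ℝ f) {j : ℕ} {L : ℝ}
    (hL : ∀ t, |rotationSum α (deriv f) j t| ≤ L) (t t' : ℝ) :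
    |rotationSum α f j t' - rotationSum α f j t| ≤ L * |t' - t| :=
  Convex.norm_image_sub_le_of_norm_hasDerivWithin_le
    (fun x _ => (hasDerivAt_rotationSum α hf j x).hasDerivWithinAt) (fun x _ => hL x)
    convex_univ (Set.mem_univ t) (Set.mem_univ t')

/-! ### Topology of the phase space -/

namespace HeisenbergNilmanifold

theorem isOpenQuotientMap_mk : IsOpenQuotientMap mk :=
  MulAction.isOpenQuotientMap_quotientMk (Γ := Heisenberg.lattice) (T := Heisenberg)

theorem continuous_rightTranslate :
    Continuous fun p : HeisenbergNilmanifold × Heisenberg => rightTranslate p.2 p.1 := by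
  have h := isOpenQuotientMap_mk.prodMap (IsOpenQuotientMap.id (X := Heisenberg))
  rw [← h.continuous_comp_iff]
  exact isOpenQuotientMap_mk.continuous.comp continuous_mul

end HeisenbergNilmanifold

/-- Translation of a point of `𝕋 × Γ \ G` by an element of `ℝ × G`. -/
noncomputable def translatePoint (p : UnitAddCircle × HeisenbergNilmanifold) (v : ℝ × Heisenberg) :
    UnitAddCircle × HeisenbergNilmanifold :=
  (p.1 + (v.1 : UnitAddCircle), HeisenbergNilmanifold.rightTranslate v.2 p.2)

theorem continuous_translatePoint : Continuous fun q :
    (UnitAddCircle × HeisenbergNilmanifold) × (ℝ × Heisenberg) => translatePoint q.1 q.2 := by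
  have h := HeisenbergNilmanifold.continuous_rightTranslate.comp
    ((continuous_snd.comp continuous_fst).prodMk (continuous_snd.comp continuous_snd) :
      Continuous fun q : (UnitAddCircle × HeisenbergNilmanifold) × (ℝ × Heisenberg) =>
        (q.1.2, q.2.2))
  refine Continuous.prodMk ?_ h
  exact (continuous_fst.comp continuous_fst).add
    ((AddCircle.continuous_mk' 1).comp (continuous_fst.comp continuous_snd))

/-- A continuous family of self-maps of a compact space is uniformly close to the identity near a
parameter at which it is the identity, for every metric inducing the topology. -/
theorem eventually_forall_dist_lt {Y P : Type*} [tY : TopologicalSpace Y] [CompactSpace Y]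
    [TopologicalSpace P] {a : Y → P → Y} (ha : Continuous fun q : Y × P => a q.1 q.2) {p₀ : P}
    (hp₀ : ∀ y, a y p₀ = y) (m : MetricSpace Y) (hm : m.toUniformSpace.toTopologicalSpace = tY)
    {ε : ℝ} (hε : 0 < ε) : ∀ᶠ p in 𝓝 p₀, ∀ y, m.dist y (a y p) < ε := by
  subst hm
  have h := isCompact_univ (X := Y).eventually_forall_of_forall_eventually (x₀ := p₀)
    (P := fun p y => dist y (a y p) < ε) fun y _ => by
      have hc : Continuous fun q : P × Y => dist q.2 (a q.2 q.1) :=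
        continuous_snd.dist (ha.comp continuous_swap)
      exact hc.continuousAt.eventually_lt (x₀ := (p₀, y)) continuousAt_const
        (by simpa [hp₀] using hε)
  simpa using h

theorem exists_forall_dist_translatePoint_lt
    (m : MetricSpace (UnitAddCircle × HeisenbergNilmanifold))
    (hm : m.toUniformSpace.toTopologicalSpace = instTopologicalSpaceProd) {ε : ℝ} (hε : 0 < ε) :
    ∃ δ : ℝ, 0 < δ ∧ ∀ (s : ℝ) (u : Heisenberg), |s| ≤ δ → |u.x| ≤ δ → |u.y| ≤ δ → |u.z| ≤ δ →
      ∀ p, m.dist p (translatePoint p (s, u)) < ε := by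
  have h := eventually_forall_dist_lt continuous_translatePoint (p₀ := (0, (1 : Heisenberg)))
    (by
      rintro ⟨t, y⟩
      obtain ⟨g, rfl⟩ := HeisenbergNilmanifold.isOpenQuotientMap_mk.surjective y
      simp [translatePoint, HeisenbergNilmanifold.rightTranslate_mk]) m hm hε
  let e : ℝ × Heisenberg ≃ₜ ℝ × ℝ × ℝ × ℝ :=
    (Homeomorph.refl ℝ).prodCongr Heisenberg.coordsHomeo
  have h0 : e (0, 1) = 0 := rfl
  have h' : ∀ᶠ v in 𝓝 (0 : ℝ × ℝ × ℝ × ℝ), ∀ p, m.dist p (translatePoint p (e.symm v)) < ε := by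
    have := e.symm.continuous.tendsto (0 : ℝ × ℝ × ℝ × ℝ)
    rw [← h0, e.symm_apply_apply] at this
    rw [← h0]
    exact this.eventually h
  obtain ⟨δ, hδ, hball⟩ := Metric.eventually_nhds_iff.1 h'
  refine ⟨δ / 2, half_pos hδ, fun s u hs hx hy hz p => ?_⟩
  have := hball (y := (s, u.x, u.y, u.z)) (by
    rw [dist_zero_right]
    simp only [Prod.norm_def, Real.norm_eq_abs]
    refine (max_le hs (max_le hx (max_le hy hz))).trans_lt (half_lt_self hδ)) p
  exact this

/-! ### Orbits of the skew product -/

/-- The `j`-th iterate of the cocycle of the skew product. The elements `⟨a, a, b + a ^ 2 / 2⟩` form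
a commutative subgroup, so it is given by two Birkhoff sums. -/
noncomputable def heisenbergCocycle (α : ℝ) (φ η : ℝ → ℝ) (j : ℕ) (t : ℝ) : Heisenberg :=
  ⟨rotationSum α φ j t, rotationSum α φ j t, rotationSum α η j t + rotationSum α φ j t ^ 2 / 2⟩

theorem iterate_skewProduct (α : ℝ) {φ ψ : ℝ → ℝ} (hφ : Function.Periodic φ 1)
    (hψ : Function.Periodic ψ 1) (j : ℕ) (t : ℝ) (g : Heisenberg) :
    (skewProduct α hφ hψ)^[j] ((t : UnitAddCircle), HeisenbergNilmanifold.mk g) =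
      (((t + j * α : ℝ) : UnitAddCircle), HeisenbergNilmanifold.mk
        (g * heisenbergCocycle α φ (fun t => ψ t - φ t ^ 2 / 2) j t)) := by
  induction j with
  | zero =>
    have : heisenbergCocycle α φ (fun t => ψ t - φ t ^ 2 / 2) 0 t = 1 := by
      ext <;> simp [heisenbergCocycle, rotationSum]
    simp [this]
  | succ j ih =>
    rw [Function.iterate_succ_apply', ih]
    simp only [skewProduct, Function.Periodic.lift_coe, HeisenbergNilmanifold.rightTranslate_mk]
    refine Prod.ext ?_ ?_
    · simp only [← AddCircle.coe_add]
      congr 1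
      push_cast
      ring
    · simp only [mul_assoc]
      congr 2
      ext <;> simp [heisenbergCocycle, rotationSum, Finset.sum_range_succ]
      ring

theorem abs_conj_heisenbergCocycle_le {α : ℝ} {φ η : ℝ → ℝ} {j : ℕ} {t s L δ r : ℝ}
    {u : Heisenberg} (hL : 1 ≤ L) (hδ1 : δ ≤ 1) (hr : 8 * L * r ≤ δ)
    (h1 : |rotationSum α φ j t| ≤ L) (h2 : |rotationSum α φ j (t + s)| ≤ L)
    (h3 : |rotationSum α φ j (t + s) - rotationSum α φ j t| ≤ L * |s|)
    (h4 : |rotationSum α η j (t + s) - rotationSum α η j t| ≤ L * |s|)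
    (hs : |s| ≤ r) (hx : |u.x| ≤ r) (hy : |u.y| ≤ r) (hz : |u.z| ≤ r) :
    |((heisenbergCocycle α φ η j t)⁻¹ * u * heisenbergCocycle α φ η j (t + s)).x| ≤ δ ∧
    |((heisenbergCocycle α φ η j t)⁻¹ * u * heisenbergCocycle α φ η j (t + s)).y| ≤ δ ∧
    |((heisenbergCocycle α φ η j t)⁻¹ * u * heisenbergCocycle α φ η j (t + s)).z| ≤ δ := by
  simp only [heisenbergCocycle, Heisenberg.mul_x, Heisenberg.mul_y, Heisenberg.mul_z,
    Heisenberg.inv_x, Heisenberg.inv_y, Heisenberg.inv_z]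
  set a := rotationSum α φ j t
  set a' := rotationSum α φ j (t + s)
  set e := rotationSum α η j t
  set e' := rotationSum α η j (t + s)
  have hr0 : 0 ≤ r := (abs_nonneg _).trans hs
  have hrL : r ≤ L * r := le_mul_of_one_le_left hr0 hL
  have hsL : L * |s| ≤ L * r := by gcongr
  have h3' : |a' - a| ≤ L * r := h3.trans hsL
  have h4' : |e' - e| ≤ L * r := h4.trans hsL
  have h5 : |a * u.y| ≤ L * r := by rw [abs_mul]; gcongr
  have h6 : |u.x * a'| ≤ L * r := by rw [abs_mul, mul_comm L]; gcongr
  have h7 : (a' - a) ^ 2 / 2 ≤ L * r := by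
    rw [← sq_abs]
    nlinarith [abs_nonneg (a' - a)]
  have h8 : 0 ≤ (a' - a) ^ 2 / 2 := by positivity
  have hez : a * a - (e + a ^ 2 / 2) + u.z + -a * u.y + (e' + a' ^ 2 / 2) + (-a + u.x) * a'
      = u.z - a * u.y + u.x * a' + (e' - e) + (a' - a) ^ 2 / 2 := by ring
  rw [hez]
  simp only [abs_le] at *
  refine ⟨⟨?_, ?_⟩, ⟨?_, ?_⟩, ?_, ?_⟩ <;> linarith

/-! ### Counting -/

theorem coveringNumber_le {X ι : Type*} [MeasurableSpace X] [Fintype ι] {d : X → X → ℝ} {T : X → X}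
    {ρ : Measure X} [IsProbabilityMeasure ρ] {ε : ℝ} (hε : 0 < ε) {n : ℕ} (hn : 0 < n) (c : ι → X)
    (h : ∀ y, ∃ i, ∀ j ≤ n, d (T^[j] (c i)) (T^[j] y) < ε) :
    coveringNumber d T ρ ε n ≤ Fintype.card ι := by
  refine iInf₂_le_of_le (Fintype.card ι) ⟨c ∘ (Fintype.equivFin ι).symm, ?_⟩ le_rfl
  have : (⋃ j, meanOrbitBall d T n ((c ∘ (Fintype.equivFin ι).symm) j) ε) = Set.univ := by
    rw [Set.eq_univ_iff_forall]
    intro y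
    obtain ⟨i, hi⟩ := h y
    refine Set.mem_iUnion.2 ⟨Fintype.equivFin ι i, ?_⟩
    have hn' : (0 : ℝ) < n := by exact_mod_cast hn
    have hs := Finset.sum_lt_sum_of_nonempty (s := Finset.range n)
      (Finset.nonempty_range_iff.2 hn.ne') fun j hj => hi j (Finset.mem_range.1 hj).le
    simp only [Finset.sum_const, Finset.card_range, nsmul_eq_mul] at hs
    simp only [meanOrbitBall, meanOrbitDist, Set.mem_ofPred_eq, Function.comp_apply,
      Equiv.symm_apply_apply]
    rw [one_div, inv_mul_lt_iff₀ hn']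
    exact hs
  rw [this, probReal_univ]
  linarith

theorem exists_fin_abs_sub_le {N : ℕ} (hN : 0 < N) {x : ℝ} (hx : x ∈ Set.Ico (0 : ℝ) 1) :
    ∃ k : Fin N, |x - (k : ℕ) / N| ≤ 1 / N := by
  have hN' : (0 : ℝ) < N := by exact_mod_cast hN
  have h0 : 0 ≤ N * x := mul_nonneg hN'.le hx.1
  refine ⟨⟨⌊N * x⌋₊, ?_⟩, ?_⟩
  · rw [Nat.floor_lt h0]
    exact mul_lt_of_lt_one_right hN' hx.2
  · have h1 := Nat.floor_le h0
    have h2 := Nat.lt_floor_add_one (N * x)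
    have e : x - (⌊N * x⌋₊ : ℝ) / N = (N * x - ⌊N * x⌋₊) / N := by field_simp
    simp only
    rw [e, abs_div, abs_of_pos hN', abs_of_nonneg (by linarith)]
    gcongr
    linarith

/-- The points of the grid of mesh `1 / N` in the unit cube. -/
noncomputable def gridPoint (N : ℕ) (k : Fin N × Fin N × Fin N × Fin N) : ℝ × Heisenberg :=
  ((k.1 : ℕ) / (N : ℝ),
    ⟨(k.2.1 : ℕ) / (N : ℝ), (k.2.2.1 : ℕ) / (N : ℝ), (k.2.2.2 : ℕ) / (N : ℝ)⟩)

theorem HeisenbergNilmanifold.exists_mk_eq (y : HeisenbergNilmanifold) :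
    ∃ g : Heisenberg, g.x ∈ Set.Ico (0 : ℝ) 1 ∧ g.y ∈ Set.Ico (0 : ℝ) 1 ∧
      g.z ∈ Set.Ico (0 : ℝ) 1 ∧ mk g = y := by
  obtain ⟨g, rfl⟩ := isOpenQuotientMap_mk.surjective y
  let γ : Heisenberg := ⟨(-⌊g.x⌋ : ℤ), (-⌊g.y⌋ : ℤ), (-⌊g.z + (-⌊g.x⌋ : ℤ) * g.y⌋ : ℤ)⟩
  refine ⟨γ * g, ?_, ?_, ?_, ((mk_eq_mk_iff g (γ * g)).2 ⟨γ, ⟨_, _, _, rfl⟩, rfl⟩).symm⟩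
  · have := Int.fract_nonneg g.x
    have := Int.fract_lt_one g.x
    simp only [Int.fract] at *
    constructor <;> simp only [γ, Heisenberg.mul_x] <;> push_cast <;> linarith
  · have := Int.fract_nonneg g.y
    have := Int.fract_lt_one g.y
    simp only [Int.fract] at *
    constructor <;> simp only [γ, Heisenberg.mul_y] <;> push_cast <;> linarith
  · have := Int.fract_nonneg (g.z + (-⌊g.x⌋ : ℤ) * g.y)
    have := Int.fract_lt_one (g.z + (-⌊g.x⌋ : ℤ) * g.y)
    simp only [Int.fract] at *
    constructor <;> simp only [γ, Heisenberg.mul_z] <;> push_cast at * <;> linarith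

theorem exists_gridPoint_near {N : ℕ} (hN : 0 < N)
    (p : UnitAddCircle × HeisenbergNilmanifold) :
    ∃ (k : Fin N × Fin N × Fin N × Fin N) (s : ℝ) (u : Heisenberg),
      |s| ≤ 2 / N ∧ |u.x| ≤ 2 / N ∧ |u.y| ≤ 2 / N ∧ |u.z| ≤ 2 / N ∧
      p = ((((gridPoint N k).1 + s : ℝ) : UnitAddCircle),
        HeisenbergNilmanifold.mk ((gridPoint N k).2 * u)) := by
  obtain ⟨t', y⟩ := p
  obtain ⟨t, ht, rfl⟩ : ∃ t : ℝ, t ∈ Set.Ico (0 : ℝ) 1 ∧ (t : UnitAddCircle) = t' := by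
    have := AddCircle.coe_image_Ico_eq (p := (1 : ℝ)) 0
    have h : t' ∈ ((↑) : ℝ → UnitAddCircle) '' Set.Ico (0 : ℝ) (0 + 1) := by
      rw [this]; trivial
    simpa using h
  obtain ⟨g, hx, hy, hz, rfl⟩ := HeisenbergNilmanifold.exists_mk_eq y
  obtain ⟨k0, h0⟩ := exists_fin_abs_sub_le hN ht
  obtain ⟨k1, h1⟩ := exists_fin_abs_sub_le hN hx
  obtain ⟨k2, h2⟩ := exists_fin_abs_sub_le hN hy
  obtain ⟨k3, h3⟩ := exists_fin_abs_sub_le hN hz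
  have hN' : (0 : ℝ) < N := by exact_mod_cast hN
  have hle : 1 / (N : ℝ) ≤ 2 / N := by gcongr; norm_num
  have h12 : (1 : ℝ) / N + 1 / N = 2 / N := by ring
  have hk1 : ((k1 : ℕ) : ℝ) / N ≤ 1 := by
    rw [div_le_one hN']; exact_mod_cast k1.2.le
  refine ⟨(k0, k1, k2, k3), t - (k0 : ℕ) / N, (gridPoint N (k0, k1, k2, k3)).2⁻¹ * g,
    h0.trans hle, ?_, ?_, ?_, ?_⟩
  · simp only [gridPoint, Heisenberg.mul_x, Heisenberg.inv_x]
    rw [neg_add_eq_sub]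
    exact h1.trans hle
  · simp only [gridPoint, Heisenberg.mul_y, Heisenberg.inv_y]
    rw [neg_add_eq_sub]
    exact h2.trans hle
  · simp only [gridPoint, Heisenberg.mul_z, Heisenberg.inv_z, Heisenberg.inv_x]
    have e : ((k1 : ℕ) : ℝ) / N * ((k2 : ℕ) / N) - (k3 : ℕ) / N + g.z + -(((k1 : ℕ) : ℝ) / N) * g.y
      = (g.z - (k3 : ℕ) / N) - ((k1 : ℕ) : ℝ) / N * (g.y - (k2 : ℕ) / N) := by ring
    rw [e, ← h12]
    refine (abs_sub _ _).trans (add_le_add h3 ?_)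
    rw [abs_mul, abs_of_nonneg (by positivity), ← one_mul (1 / (N : ℝ))]
    exact mul_le_mul hk1 h2 (abs_nonneg _) zero_le_one
  · rw [mul_inv_cancel_left]
    simp [gridPoint]

/-- At time `Q ^ M`, the orbits of length `Q ^ M` are covered by `O(Q ^ 8)` orbits, where the
exponent `8` does not depend on `M`. -/
theorem exists_coveringNumber_le (α : ℝ) {φ ψ : ℝ → ℝ} (hφ : ContDiff ℝ ∞ φ)
    (hψ : ContDiff ℝ ∞ ψ) (hφp : Function.Periodic φ 1) (hψp : Function.Periodic ψ 1)
    (hφ0 : ∫ t in (0 : ℝ)..1, φ t = 0)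
    (ρ : Measure (UnitAddCircle × HeisenbergNilmanifold)) [IsProbabilityMeasure ρ]
    (m : MetricSpace (UnitAddCircle × HeisenbergNilmanifold))
    (hm : m.toUniformSpace.toTopologicalSpace = instTopologicalSpaceProd) {ε : ℝ} (hε : 0 < ε)
    (M : ℕ) :
    ∃ K : ℕ, ∀ Q : ℕ, 0 < Q → SeparatedUpTo α Q →
      coveringNumber m.dist (skewProduct α hφp hψp) ρ ε (Q ^ M) ≤ ((K * Q ^ 2) ^ 4 : ℕ) := by
  let η : ℝ → ℝ := fun t => ψ t - φ t ^ 2 / 2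
  have hη : ContDiff ℝ ∞ η := hψ.sub ((hφ.pow 2).div_const 2)
  have hηp : Function.Periodic η 1 := fun t => by simp only [η, hφp t, hψp t]
  obtain ⟨C₁, hC₁, h₁⟩ := exists_abs_rotationSum_le α M hφ hφp hφ0
  obtain ⟨C₂, hC₂, h₂⟩ := exists_abs_rotationSum_le α M (contDiff_infty_iff_deriv.1 hφ).2
    (periodic_deriv hφp) (integral_deriv_eq_zero_of_periodic hφ hφp)
  obtain ⟨C₃, hC₃, h₃⟩ := exists_abs_rotationSum_le α M (contDiff_infty_iff_deriv.1 hη).2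
    (periodic_deriv hηp) (integral_deriv_eq_zero_of_periodic hη hηp)
  obtain ⟨δ₀, hδ₀, hclose⟩ := exists_forall_dist_translatePoint_lt m hm hε
  set C := C₁ + C₂ + C₃ + 1 with hC
  set δ := min δ₀ 1
  have hδ : 0 < δ := lt_min hδ₀ one_pos
  obtain ⟨K, hK⟩ := exists_nat_gt (16 * C / δ)
  refine ⟨K, fun Q hQ hsep => ?_⟩
  have hQ1 : (1 : ℝ) ≤ (Q : ℝ) ^ 2 := one_le_pow₀ (by exact_mod_cast hQ)
  have hK0 : (0 : ℝ) < K := lt_of_le_of_lt (by positivity) hK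
  have hKnat : 0 < K := by exact_mod_cast hK0
  set N := K * Q ^ 2 with hN
  have hNpos : 0 < N := by positivity
  have hNr : (N : ℝ) = K * (Q : ℝ) ^ 2 := by simp [hN]
  have hL1 : 1 ≤ C * (Q : ℝ) ^ 2 := one_le_mul_of_one_le_of_one_le (by linarith) hQ1
  have hr : 8 * (C * (Q : ℝ) ^ 2) * (2 / N) ≤ δ := by
    rw [hNr]
    rw [div_lt_iff₀ hδ] at hK
    calc 8 * (C * (Q : ℝ) ^ 2) * (2 / (K * (Q : ℝ) ^ 2)) = 16 * C / K := by
          field_simp; ring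
      _ ≤ δ := by rw [div_le_iff₀ hK0]; linarith
  have hle : ∀ c, c ≤ C → c * (Q : ℝ) ^ 2 ≤ C * (Q : ℝ) ^ 2 := fun c hc => by gcongr
  have hcov := coveringNumber_le (ρ := ρ) (d := m.dist) (T := skewProduct α hφp hψp) hε
    (n := Q ^ M) (by positivity)
    (fun k : Fin N × Fin N × Fin N × Fin N =>
      (((gridPoint N k).1 : UnitAddCircle), HeisenbergNilmanifold.mk (gridPoint N k).2)) ?_
  · refine hcov.trans (le_of_eq ?_)
    simp only [Fintype.card_prod, Fintype.card_fin]
    congr 1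
    ring
  intro p
  obtain ⟨k, s, u, hs, hx, hy, hz, rfl⟩ := exists_gridPoint_near hNpos p
  refine ⟨k, fun j hj => ?_⟩
  set t := (gridPoint N k).1
  set g := (gridPoint N k).2
  rw [iterate_skewProduct, iterate_skewProduct]
  obtain ⟨hx', hy', hz'⟩ := abs_conj_heisenbergCocycle_le (η := η) (δ := δ) (u := u) hL1
    (min_le_right _ _) hr
    ((h₁ Q hQ hsep j hj t).trans (hle _ (by linarith)))
    ((h₁ Q hQ hsep j hj (t + s)).trans (hle _ (by linarith)))
    (by
      have := abs_rotationSum_sub_le (hφ.differentiable (by simp))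
        (fun x => (h₂ Q hQ hsep j hj x).trans (hle _ (by linarith))) t (t + s)
      simpa using this)
    (by
      have := abs_rotationSum_sub_le (hη.differentiable (by simp))
        (fun x => (h₃ Q hQ hsep j hj x).trans (hle _ (by linarith))) t (t + s)
      simpa using this) hs hx hy hz
  have hδle : δ ≤ δ₀ := min_le_left _ _
  have hsδ : |s| ≤ δ := by
    refine hs.trans (le_trans ?_ hr)
    have : (0 : ℝ) ≤ 2 / N := by positivity
    nlinarith
  have := hclose s _ (hsδ.trans hδle) (hx'.trans hδle) (hy'.trans hδle) (hz'.trans hδle)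
    (((t + j * α : ℝ) : UnitAddCircle), HeisenbergNilmanifold.mk (g * heisenbergCocycle α φ η j t))
  convert! this using 2
  refine Prod.ext ?_ ?_
  · simp only [translatePoint, ← AddCircle.coe_add]
    congr 1
    ring
  · simp only [translatePoint, HeisenbergNilmanifold.rightTranslate_mk]
    congr 1
    simp only [mul_assoc, mul_inv_cancel_left, η]

theorem proposition6p1 (α : ℝ) (hα : α ∈ Set.Ico (0 : ℝ) 1) (hirr : Irrational α)
    (φ ψ : ℝ → ℝ) (hφ : ContDiff ℝ ∞ φ) (hψ : ContDiff ℝ ∞ ψ)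
    (hφp : Function.Periodic φ 1) (hψp : Function.Periodic ψ 1)
    (hφ0 : ∫ t in (0 : ℝ)..1, φ t = 0)
    (ρ : Measure (UnitAddCircle × HeisenbergNilmanifold)) [IsProbabilityMeasure ρ]
    (hρ : MeasurePreserving (skewProduct α hφp hψp) ρ ρ) :
    SubpolynomialMeasureComplexity (skewProduct α hφp hψp) ρ := by
  intro τ hτ m hm ε hε
  obtain ⟨M, hM⟩ := exists_nat_gt (9 / τ)
  have hM9 : 9 ≤ M * τ := by rw [div_lt_iff₀ hτ] at hM; exact hM.le
  have hMpos : 0 < M := by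
    have : (0 : ℝ) < M := lt_trans (by positivity) hM
    exact_mod_cast this
  obtain ⟨K, hK⟩ := exists_coveringNumber_le α hφ hψ hφp hψp hφ0 ρ m hm hε M
  refine le_antisymm (ENNReal.le_of_forall_pos_le_add fun δ hδ _ => ?_) zero_le
  rw [zero_add]
  refine liminf_le_of_frequently_le' ?_
  have htend : Tendsto (fun Q : ℕ => Q ^ M) atTop atTop := tendsto_pow_atTop hMpos.ne'
  refine htend.frequently (p := fun n : ℕ => _ ≤ (δ : ℝ≥0∞)) ?_
  obtain ⟨R, hR⟩ := exists_nat_gt ((K : ℝ) ^ 4 / δ)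
  refine ((frequently_separatedUpTo hirr).and_eventually (eventually_ge_atTop (R + 1))).mono ?_
  rintro Q ⟨hsep, hQR⟩
  have hQ : 0 < Q := by omega
  have hQ0 : (0 : ℝ) < Q := by exact_mod_cast hQ
  have hQ1 : (1 : ℝ) ≤ Q := by exact_mod_cast hQ
  have hδ' : (0 : ℝ) < δ := by exact_mod_cast hδ
  have hpow : (Q : ℝ) ^ 9 ≤ ((Q ^ M : ℕ) : ℝ) ^ τ := by
    rw [Nat.cast_pow, ← Real.rpow_natCast (Q : ℝ) M, ← Real.rpow_mul hQ0.le,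
      ← Real.rpow_natCast (Q : ℝ) 9]
    exact Real.rpow_le_rpow_of_exponent_le hQ1 (by exact_mod_cast hM9)
  have hreal : (((K * Q ^ 2) ^ 4 : ℕ) : ℝ) ≤ δ * ((Q ^ M : ℕ) : ℝ) ^ τ := by
    have hRQ : (R : ℝ) ≤ Q := by exact_mod_cast (by omega : R ≤ Q)
    have hKQ : (K : ℝ) ^ 4 ≤ δ * Q := by
      rw [div_lt_iff₀ hδ'] at hR
      nlinarith
    calc (((K * Q ^ 2) ^ 4 : ℕ) : ℝ) = (K : ℝ) ^ 4 * (Q : ℝ) ^ 8 := by push_cast; ring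
      _ ≤ δ * Q * (Q : ℝ) ^ 8 := by gcongr
      _ = δ * (Q : ℝ) ^ 9 := by ring
      _ ≤ _ := by gcongr
  have hcov : ((coveringNumber m.dist (skewProduct α hφp hψp) ρ ε (Q ^ M) : ℕ∞) : ℝ≥0∞)
      ≤ (((K * Q ^ 2) ^ 4 : ℕ) : ℝ≥0∞) := by
    have := ENat.toENNReal_le.2 (hK Q hQ hsep)
    rwa [ENat.toENNReal_coe] at this
  refine ENNReal.div_le_of_le_mul (hcov.trans ?_)
  rw [← ENNReal.ofReal_natCast, ← ENNReal.ofReal_coe_nnreal, ← ENNReal.ofReal_mul hδ'.le]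
  exact ENNReal.ofReal_le_ofReal hreal
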